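/- **Setting.** Let $B=B_0\oplus B_1$ be a commutative superalgebra over a field of characteristic $0$ (commutativity: $ab=(-1)^{\tilde a\tilde b}ba$ for homogeneous $a,b$) with an even derivation $\partial_x$; for example $B$ is the algebra of smooth functions of an even variable $x$ and of any further even and odd parameters, and $\partial_x=\partial/\partial x$. Functions on the superline are the elements $f=f^0+\xi f^1$ with $f^0,f^1\in B$, where $\xi$ is odd, $\xi^2=0$ and $b\xi=(-1)^{\tilde b}\xi b$ for homogeneous $b\in B$; $f$ is even (odd) if $f^0$ is even (odd) and $f^1$ is odd (even). Let $D=\partial_\xi+\xi\partial_x$, i.e. $D(f^0+\xi f^1)=f^1+\xi\,\partial_xf^0$. For a square matrix $A$ whose rows and columns (numbered from $0$) have the parities $i \bmod 2$, let $A_{ab}$ denote the block formed by the rows of parity $a$ and the columns of parity $b$, in their original order, and put $$\mathrm{Ber}\,A=\frac{\det(A_{00}-A_{01}A_{11}^{-1}A_{10})}{\det A_{11}},\qquad \mathrm{Ber}^*A=\frac{\det(A_{11}-A_{10}A_{00}^{-1}A_{01})}{\det A_{00}},$$ defined when $A_{11}$, respectively $A_{00}$, is invertible. The same formulas are used if one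 even row (for $\mathrm{Ber}$) or one odd row (for $\mathrm{Ber}^*$) of an even matrix is replaced by a row of the wrong parity; in the determinants that occur all rows but at most one then have even entries, so these determinants make sense. For functions $\varphi_0,\dots,\varphi_n$ on the superline, where $\varphi_j$ has parity $j\bmod 2$, let $\mathcal W(\varphi_0,\dots,\varphi_n)=(D^i\varphi_j)_{i,j=0}^n$ be the Wroński matrix, and $\mathcal W'(\varphi_0,\dots,\varphi_n)$ the matrix obtained from it by replacing the last row $(D^n\varphi_j)_j$ with $(D^{n+1}\varphi_j)_j$. Put $W=\mathrm{Ber}\,\mathcal W$ and $W^*=\mathrm{Ber}^*\mathcal W$. **Lemma (differentiation of super Wronskians).** Let $s\ge 0$. 1. If $W(\varphi_0,\dots,\varphi_{2s})$ is defined, then so is the right-hand side below, and $$D\,W(\varphi_0,\dots,\varphi_{2s})=\mathrm{Ber}\,\mathcal W'(\varphi_0,\dots,\varphi_{2s}).$$ 2. If $W$ and $W^*$ of $\varphi_0,\dots,\varphi_{2s+1}$ are both defined, then so is the right-hand side below, and $$D\,W(\varphi_0,\dots,\varphi_{2s+1})=-W(\varphi_0,\dots,\varphi_{2s+1})^2\;\mathrm{Ber}^*\,\mathcal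 W'(\varphi_0,\dots,\varphi_{2s+1}).$$ 3. If $W^*(\varphi_0,\dots,\varphi_{2s+1})$ is defined, then so is the right-hand side below, and $$D\,W^*(\varphi_0,\dots,\varphi_{2s+1})=\mathrm{Ber}^*\,\mathcal W'(\varphi_0,\dots,\varphi_{2s+1}).$$ 4. If $W$ and $W^*$ of $\varphi_0,\dots,\varphi_{2s}$ are both defined, then so is the right-hand side below, and $$D\,W^*(\varphi_0,\dots,\varphi_{2s})=-W^*(\varphi_0,\dots,\varphi_{2s})^2\;\mathrm{Ber}\,\mathcal W'(\varphi_0,\dots,\varphi_{2s}).$$ -/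

import Mathlib

/-- A `ZMod 2`-graded algebra (superalgebra) is commutative in the graded sense:
`a b = (-1)^{|a||b|} b a` for homogeneous `a`, `b`. -/
def IsSupercommutative {K B : Type*} [Field K] [Ring B] [Algebra K B]
    (𝓑 : ZMod 2 → Submodule K B) : Prop :=
  ∀ (i j : ZMod 2) (a b : B), a ∈ 𝓑 i → b ∈ 𝓑 j → a * b = (-1) ^ (i.val * j.val) * (b * a)

/-- An even derivation of a superalgebra: a parity preserving linear map satisfying the
Leibniz rule. -/
structure IsEvenDerivation {K B : Type*} [Field K] [Ring B] [Algebra K B]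
    (𝓑 : ZMod 2 → Submodule K B) (d : B →ₗ[K] B) : Prop where
  map_mem : ∀ (i : ZMod 2) (a : B), a ∈ 𝓑 i → d a ∈ 𝓑 i
  leibniz : ∀ a b : B, d (a * b) = d a * b + a * d b

section parityInvolution

variable {K B : Type*} [Field K] [Ring B] [Algebra K B]
  (𝓑 : ZMod 2 → Submodule K B) [GradedAlgebra 𝓑]

/-- The parity involution `b = b₀ + b₁ ↦ b₀ - b₁` of a superalgebra. -/
def parityInvolution (b : B) : B :=
  (DirectSum.decompose 𝓑 b 0 : B) - (DirectSum.decompose 𝓑 b 1 : B)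

theorem parityInvolution_add (a b : B) :
    parityInvolution 𝓑 (a + b) = parityInvolution 𝓑 a + parityInvolution 𝓑 b := by
  simp only [parityInvolution, DirectSum.decompose_add, DirectSum.add_apply, Submodule.coe_add]
  abel

theorem parityInvolution_zero : parityInvolution 𝓑 (0 : B) = 0 := by
  simp [parityInvolution]

theorem parityInvolution_of_even {b : B} (hb : b ∈ 𝓑 0) : parityInvolution 𝓑 b = b := by
  have h1 : (DirectSum.decompose 𝓑 b 1 : B) = 0 :=
    DirectSum.decompose_of_mem_ne 𝓑 hb (by decide)
  rw [parityInvolution, DirectSum.decompose_of_mem_same 𝓑 hb, h1, sub_zero]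

theorem parityInvolution_of_odd {b : B} (hb : b ∈ 𝓑 1) : parityInvolution 𝓑 b = -b := by
  have h0 : (DirectSum.decompose 𝓑 b 0 : B) = 0 :=
    DirectSum.decompose_of_mem_ne 𝓑 hb (by decide)
  rw [parityInvolution, DirectSum.decompose_of_mem_same 𝓑 hb, h0, zero_sub]

theorem parityInvolution_one : parityInvolution 𝓑 (1 : B) = 1 :=
  parityInvolution_of_even 𝓑 (SetLike.GradedOne.one_mem (A := 𝓑))

theorem exists_even_add_odd (b : B) : ∃ u ∈ 𝓑 0, ∃ v ∈ 𝓑 1, b = u + v := by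
  refine ⟨(DirectSum.decompose 𝓑 b 0 : B), SetLike.coe_mem _,
    (DirectSum.decompose 𝓑 b 1 : B), SetLike.coe_mem _, ?_⟩
  classical
  conv_lhs => rw [← DirectSum.sum_support_decompose 𝓑 b]
  rw [Finset.sum_subset (Finset.subset_univ _) (fun i _ hi => by simpa using hi)]
  exact Fin.sum_univ_two (fun i : Fin 2 => (DirectSum.decompose 𝓑 b i : B))

theorem parityInvolution_mul (a b : B) :
    parityInvolution 𝓑 (a * b) = parityInvolution 𝓑 a * parityInvolution 𝓑 b := by
  obtain ⟨u, hu, v, hv, rfl⟩ := exists_even_add_odd 𝓑 a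
  obtain ⟨w, hw, z, hz, rfl⟩ := exists_even_add_odd 𝓑 b
  have huw : u * w ∈ 𝓑 0 := by simpa using SetLike.GradedMul.mul_mem hu hw
  have huz : u * z ∈ 𝓑 1 := by simpa using SetLike.GradedMul.mul_mem hu hz
  have hvw : v * w ∈ 𝓑 1 := by simpa using SetLike.GradedMul.mul_mem hv hw
  have hvz : v * z ∈ 𝓑 0 := SetLike.GradedMul.mul_mem hv hz
  simp only [add_mul, mul_add, parityInvolution_add, parityInvolution_of_even 𝓑 hu,
    parityInvolution_of_odd 𝓑 hv, parityInvolution_of_even 𝓑 hw, parityInvolution_of_odd 𝓑 hz,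
    parityInvolution_of_even 𝓑 huw, parityInvolution_of_odd 𝓑 huz,
    parityInvolution_of_odd 𝓑 hvw, parityInvolution_of_even 𝓑 hvz]
  noncomm_ring

theorem parityInvolution_neg (a : B) :
    parityInvolution 𝓑 (-a) = -parityInvolution 𝓑 a := by
  have h := parityInvolution_add 𝓑 a (-a)
  rw [add_neg_cancel, parityInvolution_zero] at h
  exact (neg_eq_of_add_eq_zero_right h.symm).symm

end parityInvolution

/-- Functions on the superline. If `B` is the superalgebra of functions of the even coordinate `x`
(and of the even and odd parameters), a function on the superline is
`f(x, ξ) = f⁰(x) + ξ f¹(x)`, with coefficients `f⁰ = coeff0` and `f¹ = coeff1` in `B`. -/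
@[ext]
structure SuperlineFunction {K B : Type*} [Field K] [Ring B] [Algebra K B]
    (𝓑 : ZMod 2 → Submodule K B) where
  coeff0 : B
  coeff1 : B

namespace SuperlineFunction

variable {K B : Type*} [Field K] [Ring B] [Algebra K B] {𝓑 : ZMod 2 → Submodule K B}

instance : Zero (SuperlineFunction 𝓑) := ⟨⟨0, 0⟩⟩

instance : One (SuperlineFunction 𝓑) := ⟨⟨1, 0⟩⟩

instance : Add (SuperlineFunction 𝓑) :=
  ⟨fun f g => ⟨f.coeff0 + g.coeff0, f.coeff1 + g.coeff1⟩⟩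

instance : Neg (SuperlineFunction 𝓑) := ⟨fun f => ⟨-f.coeff0, -f.coeff1⟩⟩

/-- The product determined by `ξ² = 0` and `b ξ = (-1)^{|b|} ξ b`. -/
instance [GradedAlgebra 𝓑] : Mul (SuperlineFunction 𝓑) :=
  ⟨fun f g => ⟨f.coeff0 * g.coeff0,
    f.coeff1 * g.coeff0 + parityInvolution 𝓑 f.coeff0 * g.coeff1⟩⟩

@[simp] theorem zero_coeff0 : (0 : SuperlineFunction 𝓑).coeff0 = 0 := rfl
@[simp] theorem zero_coeff1 : (0 : SuperlineFunction 𝓑).coeff1 = 0 := rfl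
@[simp] theorem one_coeff0 : (1 : SuperlineFunction 𝓑).coeff0 = 1 := rfl
@[simp] theorem one_coeff1 : (1 : SuperlineFunction 𝓑).coeff1 = 0 := rfl
@[simp] theorem add_coeff0 (f g : SuperlineFunction 𝓑) :
    (f + g).coeff0 = f.coeff0 + g.coeff0 := rfl
@[simp] theorem add_coeff1 (f g : SuperlineFunction 𝓑) :
    (f + g).coeff1 = f.coeff1 + g.coeff1 := rfl
@[simp] theorem neg_coeff0 (f : SuperlineFunction 𝓑) : (-f).coeff0 = -f.coeff0 := rfl
@[simp] theorem neg_coeff1 (f : SuperlineFunction 𝓑) : (-f).coeff1 = -f.coeff1 := rfl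
@[simp] theorem mul_coeff0 [GradedAlgebra 𝓑] (f g : SuperlineFunction 𝓑) :
    (f * g).coeff0 = f.coeff0 * g.coeff0 := rfl
@[simp] theorem mul_coeff1 [GradedAlgebra 𝓑] (f g : SuperlineFunction 𝓑) :
    (f * g).coeff1 = f.coeff1 * g.coeff0 + parityInvolution 𝓑 f.coeff0 * g.coeff1 := rfl

instance [GradedAlgebra 𝓑] : Ring (SuperlineFunction 𝓑) where
  add_assoc f g h := by ext <;> simp [add_assoc]
  zero_add f := by ext <;> simp
  add_zero f := by ext <;> simp
  add_comm f g := by ext <;> simp [add_comm]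
  left_distrib f g h := by
    ext
    · simp [mul_add]
    · simp only [mul_coeff1, add_coeff0, add_coeff1, mul_add]; abel
  right_distrib f g h := by
    ext
    · simp [add_mul]
    · simp only [mul_coeff1, add_coeff0, add_coeff1, add_mul, parityInvolution_add]; abel
  zero_mul f := by ext <;> simp [parityInvolution_zero]
  mul_zero f := by ext <;> simp
  mul_assoc f g h := by
    ext
    · simp [mul_assoc]
    · simp only [mul_coeff0, mul_coeff1, add_mul, mul_add, parityInvolution_mul, mul_assoc]; abel
  one_mul f := by ext <;> simp [parityInvolution_one]
  mul_one f := by ext <;> simp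
  neg_add_cancel f := by ext <;> simp
  nsmul := nsmulRec
  zsmul := zsmulRec

/-- `f = f⁰ + ξ f¹` is homogeneous of parity `p`: since `ξ` is odd, this means that `f⁰` has
parity `p` and `f¹` has parity `p + 1`. -/
def HasParity (f : SuperlineFunction 𝓑) (p : ZMod 2) : Prop :=
  f.coeff0 ∈ 𝓑 p ∧ f.coeff1 ∈ 𝓑 (p + 1)

/-- The operator `D = ∂_ξ + ξ ∂_x`, where `∂_x` is the derivation `dx` acting on the coefficients:
`D (f⁰ + ξ f¹) = f¹ + ξ ∂_x f⁰`. -/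
def superD (dx : B →ₗ[K] B) (f : SuperlineFunction 𝓑) : SuperlineFunction 𝓑 :=
  ⟨f.coeff1, dx f.coeff0⟩

end SuperlineFunction

noncomputable section

/-- The determinant `∑_σ sgn σ ∏_i M i (σ i)` of a matrix over a possibly noncommutative ring, the
factors being taken in the order of the rows. Below, all rows but at most one consist of central
(even) entries, so that the order of the factors is immaterial. -/
def rowDet {R ι : Type*} [Ring R] [Fintype ι] [LinearOrder ι] (M : Matrix ι ι R) : R :=
  ∑ σ : Equiv.Perm ι, ((Equiv.Perm.sign σ : ℤˣ) : ℤ) •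
    ((Finset.univ.sort (· ≤ ·) : List ι).map fun i => M i (σ i)).prod

/-- For a square matrix whose `i`-th row and `i`-th column both have the label (parity) `p i`, the
block formed by the rows of parity `a` and the columns of parity `b`, in their original order. -/
def superBlock {R ι : Type*} (p : ι → ZMod 2) (A : Matrix ι ι R) (a b : ZMod 2) :
    Matrix {i // p i = a} {j // p j = b} R :=
  A.submatrix Subtype.val Subtype.val

/-- The Berezinian of `A` is defined when its odd-odd block is invertible. -/
def BerDefined {R ι : Type*} [Ring R] [Fintype ι] [LinearOrder ι]
    (p : ι → ZMod 2) (A : Matrix ι ι R) : Prop :=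
  IsUnit (superBlock p A 1 1)

/-- The Berezinian `det (A₀₀ - A₀₁ A₁₁⁻¹ A₁₀) / det A₁₁` with respect to the format `p`. The same
formula is used for even matrices and for those with one even row of the wrong parity. -/
def ber {R ι : Type*} [Ring R] [Fintype ι] [LinearOrder ι]
    (p : ι → ZMod 2) (A : Matrix ι ι R) : R :=
  rowDet (superBlock p A 0 0 -
      superBlock p A 0 1 * Ring.inverse (superBlock p A 1 1) * superBlock p A 1 0) *
    Ring.inverse (rowDet (superBlock p A 1 1))

/-- The reversed format, in which all parities of rows and columns are changed. -/
def reversedFormat {ι : Type*} (p : ι → ZMod 2) : ι → ZMod 2 := fun i => p i + 1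

/-- The inverse Berezinian is defined when the even-even block is invertible. -/
def BerStarDefined {R ι : Type*} [Ring R] [Fintype ι] [LinearOrder ι]
    (p : ι → ZMod 2) (A : Matrix ι ι R) : Prop :=
  BerDefined (reversedFormat p) A

/-- The inverse Berezinian `Ber* A = Ber A^Π`. -/
def berStar {R ι : Type*} [Ring R] [Fintype ι] [LinearOrder ι]
    (p : ι → ZMod 2) (A : Matrix ι ι R) : R :=
  ber (reversedFormat p) A

/-- The alternating format: the `i`-th row and column have parity `i mod 2`, counting from `0`. -/
def altFormat (N : ℕ) : Fin N → ZMod 2 := fun i => ((i : ℕ) : ZMod 2)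

section wronskians

variable {K B : Type*} [Field K] [Ring B] [Algebra K B] {𝓑 : ZMod 2 → Submodule K B}

/-- The Wroński matrix `(Dⁱ φⱼ)`. -/
def wronskiMatrix (dx : B →ₗ[K] B) {N : ℕ} (φ : Fin N → SuperlineFunction 𝓑) :
    Matrix (Fin N) (Fin N) (SuperlineFunction 𝓑) :=
  Matrix.of fun i j => (SuperlineFunction.superD dx)^[(i : ℕ)] (φ j)

/-- The Wroński matrix of `φ₀, …, φₙ` with its last row `(Dⁿ φⱼ)` replaced by `(Dⁿ⁺¹ φⱼ)`. -/
def wronskiMatrixShifted (dx : B →ₗ[K] B) {n : ℕ} (φ : Fin (n + 1) → SuperlineFunction 𝓑) :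
    Matrix (Fin (n + 1)) (Fin (n + 1)) (SuperlineFunction 𝓑) :=
  (wronskiMatrix dx φ).updateRow (Fin.last n)
    fun j => (SuperlineFunction.superD dx)^[n + 1] (φ j)

/-- The super Wronskian. -/
def superWronskian [GradedAlgebra 𝓑] (dx : B →ₗ[K] B) {N : ℕ}
    (φ : Fin N → SuperlineFunction 𝓑) : SuperlineFunction 𝓑 :=
  ber (altFormat N) (wronskiMatrix dx φ)

/-- The inverse super Wronskian. -/
def superWronskianStar [GradedAlgebra 𝓑] (dx : B →ₗ[K] B) {N : ℕ}
    (φ : Fin N → SuperlineFunction 𝓑) : SuperlineFunction 𝓑 :=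
  berStar (altFormat N) (wronskiMatrix dx φ)

/-- The parities of `φ₀, φ₁, φ₂, …` are even, odd, even, and so on. -/
def AlternatingParity {N : ℕ} (φ : Fin N → SuperlineFunction 𝓑) : Prop :=
  ∀ j : Fin N, (φ j).HasParity ((j : ℕ) : ZMod 2)

end wronskians

end

/-! Write the Wroński matrix in blocks T = A₀₀, Q = A₀₁, Q' = A₁₀, P = A₁₁. Applying D moves each
row to the next one, so DA = NA plus a correction in the last row, where N is the shift matrix. N
has entries 0 and 1 and joins only rows of opposite parity. If the last row is even for the chosen
format and J = N₁₀, then the Schur complement S = T - QP⁻¹Q' satisfies DS = (a last-row term) + ZS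
with Z = QP⁻¹J, while DP = JQ. By Jacobi's formula both det S and det P acquire the logarithmic
derivative tr Z, up to the last-row term. These traces cancel in det S / det P, and what remains is
the Berezinian with its last row replaced (`IsOddDerivation.map_berBlocks`). This gives assertion 1
and, with the parities reversed, assertion 3.

Assertions 2 and 4 follow from Ber · Ber* = 1 by differentiating w w' = 1. After factoring out det T
and det P, this identity becomes det(1 - AB) det(1 - BA) = 1 for odd A, B
(`det_one_sub_mul_det_one_sub_of_odd`): the sign in tr(AB) = -tr(BA) inverts the usual equality of
the two determinants.

All determinants are computed in the commutative ring E of even functions, over which the full ring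
R is an algebra. -/

namespace Matrix

/-! ### Jacobi's formula for a derivation with values in a module -/

section Derivation

variable {n E M : Type*} [Fintype n] [DecidableEq n] [CommRing E] [AddCommGroup M] [Module E M]

theorem det_eq_sum_rows (A : Matrix n n E) :
    A.det = ∑ σ : Equiv.Perm n, ((Equiv.Perm.sign σ : ℤˣ) : ℤ) • ∏ i, A i (σ i) := by
  rw [← det_transpose, det_apply]
  rfl

/-- The cofactor expansion of the Leibniz formula along a row with values in a module. -/
theorem sum_perm_prod_erase_smul (A : Matrix n n E) (l : n) (r : n → M) :
    ∑ σ : Equiv.Perm n, ((Equiv.Perm.sign σ : ℤˣ) : ℤ) •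
      ((∏ k ∈ Finset.univ.erase l, A k (σ k)) • r (σ l)) = ∑ j, adjugate A j l • r j := by
  -- The adjugate entry is the determinant with row l replaced by a unit vector, so only the
  -- permutations with σ l = j contribute.
  have hadj : ∀ j, adjugate A j l = ∑ σ : Equiv.Perm n, ((Equiv.Perm.sign σ : ℤˣ) : ℤ) •
      (if σ l = j then ∏ k ∈ Finset.univ.erase l, A k (σ k) else 0) := by
    intro j
    rw [adjugate_apply, det_eq_sum_rows]
    refine Finset.sum_congr rfl fun σ _ => ?_
    congr 1
    rw [← Finset.mul_prod_erase _ _ (Finset.mem_univ l), updateRow_self, Pi.single_apply]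
    have : ∏ k ∈ Finset.univ.erase l, A.updateRow l (Pi.single j 1) k (σ k) =
        ∏ k ∈ Finset.univ.erase l, A k (σ k) :=
      Finset.prod_congr rfl fun k hk => by rw [updateRow_ne (Finset.ne_of_mem_erase hk)]
    rw [this]
    split_ifs <;> simp
  simp_rw [hadj, Finset.sum_smul]
  rw [Finset.sum_comm]
  refine Finset.sum_congr rfl fun σ _ => ?_
  simp_rw [smul_assoc, ← Finset.smul_sum, ite_smul, zero_smul]
  simp

theorem _root_.Derivation.leibniz_prod_erase {S ι : Type*} [CommRing S] [Algebra S E] [Module S M]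
    [DecidableEq ι] (d : Derivation S E M) (s : Finset ι) (f : ι → E) :
    d (∏ i ∈ s, f i) = ∑ i ∈ s, (∏ k ∈ s.erase i, f k) • d (f i) := by
  induction s using Finset.induction_on with
  | empty => simp
  | insert a s ha ih =>
    rw [Finset.prod_insert ha, d.leibniz, ih, Finset.sum_insert ha, Finset.erase_insert ha,
      add_comm, Finset.smul_sum]
    congr 1
    refine Finset.sum_congr rfl fun i hi => ?_
    have hai : a ≠ i := fun h => ha (h ▸ hi)
    rw [Finset.erase_insert_of_ne hai, Finset.prod_insert (fun h => ha (Finset.mem_of_mem_erase h)),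
      mul_smul]

/-- Jacobi's formula for a derivation. -/
theorem _root_.Derivation.map_det {S : Type*} [CommRing S] [Algebra S E] [Module S M]
    (d : Derivation S E M) (A : Matrix n n E) :
    d A.det = ∑ i, ∑ j, adjugate A j i • d (A i j) := by
  simp_rw [← sum_perm_prod_erase_smul]
  rw [Finset.sum_comm, det_eq_sum_rows, map_sum]
  refine Finset.sum_congr rfl fun σ _ => ?_
  rw [map_zsmul, d.leibniz_prod_erase, Finset.smul_sum]

end Derivation

/-! ### Determinants with one row outside the even ring -/

section rowDet

variable {n E R : Type*} [LinearOrder n] [CommRing E] [Ring R] [Algebra E R]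

theorem _root_.rowDet_map_algebraMap [Fintype n] (A : Matrix n n E) :
    rowDet (A.map (algebraMap E R)) = algebraMap E R A.det := by
  rw [rowDet, det_eq_sum_rows, map_sum]
  refine Finset.sum_congr rfl fun σ _ => ?_
  rw [map_zsmul]
  congr 1
  have h : ∏ i, A i (σ i) =
      ((Finset.univ.sort (· ≤ ·) : List n).map fun i => A i (σ i)).prod := by
    rw [← Finset.prod_map_toList]
    exact ((Finset.sort_perm_toList _ _).map _).symm.prod_eq
  rw [h, map_list_prod, List.map_map]
  rfl

/-- All factors except the one at l are central, so they can be collected as a scalar. -/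
theorem _root_.List.prod_map_eq_of_nodup {L : List n} (hL : L.Nodup) {l : n} (hl : l ∈ L)
    (f : n → R) (g : n → E) (h : ∀ i, i ≠ l → f i = algebraMap E R (g i)) :
    (L.map f).prod = (∏ i ∈ L.toFinset.erase l, g i) • f l := by
  have aux : ∀ L : List n, L.Nodup → l ∉ L →
      (L.map f).prod = algebraMap E R (∏ i ∈ L.toFinset, g i) := by
    intro L hL hl
    rw [List.prod_toFinset _ hL, map_list_prod, List.map_map]
    congr 1
    exact List.map_congr_left fun i hi => h i fun e => hl (e ▸ hi)
  induction L with
  | nil => simp at hl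
  | cons a L ih =>
    rw [List.nodup_cons] at hL
    by_cases hal : a = l
    · subst hal
      rw [List.map_cons, List.prod_cons, aux L hL.2 hL.1, List.toFinset_cons,
        Finset.erase_insert (by simpa using hL.1), Algebra.smul_def, Algebra.commutes]
    · have hlL : l ∈ L := by
        rcases List.mem_cons.1 hl with h | h
        · exact absurd h.symm hal
        · exact h
      rw [List.map_cons, List.prod_cons, ih hL.2 hlL, List.toFinset_cons,
        Finset.erase_insert_of_ne hal, Finset.prod_insert (by simp [hL.1]), h a hal,
        mul_smul, ← Algebra.smul_def]

/-- The cofactors along the exceptional row lie in E. The expansion therefore has the same shape as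
one row's contribution to Jacobi's formula. -/
theorem _root_.rowDet_updateRow_map [Fintype n] (A : Matrix n n E) (l : n) (r : n → R) :
    rowDet ((A.map (algebraMap E R)).updateRow l r) = ∑ j, adjugate A j l • r j := by
  rw [← sum_perm_prod_erase_smul, rowDet]
  refine Finset.sum_congr rfl fun σ _ => ?_
  congr 1
  rw [List.prod_map_eq_of_nodup (Finset.sort_nodup _ _) (l := l) (by simp) _
    (fun i => A i (σ i)) (fun i hi => by simp [updateRow_ne hi])]
  simp

end rowDet

/-! ### The determinant identity for odd matrices -/

section Odd

section

variable {m E R : Type*} [DecidableEq m] [CommRing E] [Ring R] [Algebra E R]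

theorem smul_one_map_algebraMap (a : E) :
    (a • (1 : Matrix m m E)).map (algebraMap E R) = a • 1 := by
  ext1 i j
  by_cases h : i = j <;> simp [h, Algebra.algebraMap_eq_smul_one]

theorem one_sub_smul_map_algebraMap (c : E) (U : Matrix m m E) :
    (1 - c • U).map (algebraMap E R) = 1 - c • U.map (algebraMap E R) := by
  ext1 i j
  by_cases h : i = j <;> simp [h, Algebra.smul_def c (algebraMap E R _)]

end

variable {m n E R : Type*} [Fintype m] [Fintype n] [CommRing E] [Ring R] [Algebra E R]

theorem trace_map_mul_comm (A : Matrix m n E) (M : Matrix n m R) :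
    trace (A.map (algebraMap E R) * M) = trace (M * A.map (algebraMap E R)) := by
  simp only [trace, diag, mul_apply, map_apply, Algebra.commutes]
  exact Finset.sum_comm

theorem trace_mul_eq_neg_of_anticomm (A : Matrix m n R) (B : Matrix n m R)
    (h : ∀ i j, A i j * B j i = -(B j i * A i j)) : trace (A * B) = -trace (B * A) := by
  simp only [trace, diag, mul_apply, h, Finset.sum_neg_distrib]
  rw [Finset.sum_comm]

theorem _root_.algebraMap_trace (Z : Matrix m m E) :
    algebraMap E R (trace Z) = trace (Z.map (algebraMap E R)) := by
  simp [trace]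

variable [DecidableEq m] [DecidableEq n]

/-- This is tr((1 - cV)⁻¹V) + tr((1 - cU)⁻¹U) = 0 with denominators cleared. The relation (1 - cBA)B
= B(1 - cAB) passes to adjugates (`key`), and moving B cyclically through the trace costs a sign
because the other factor, adj(1 - cAB) A, is still odd. -/
theorem det_mul_trace_adjugate_add_of_odd (hinj : Function.Injective (algebraMap E R))
    (A : Matrix m n R) (B : Matrix n m R) (hAB : ∀ i j k l, A i j * B k l = -(B k l * A i j))
    (U : Matrix m m E) (V : Matrix n n E) (hU : U.map (algebraMap E R) = A * B)
    (hV : V.map (algebraMap E R) = B * A) (c : E) :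
    (1 - c • U).det * trace (adjugate (1 - c • V) * V) +
      (1 - c • V).det * trace (adjugate (1 - c • U) * U) = 0 := by
  set M := 1 - c • U with hM
  set N := 1 - c • V with hN
  have hM' : M.map (algebraMap E R) = 1 - c • (A * B) := by
    rw [← hU, hM, one_sub_smul_map_algebraMap]
  have hN' : N.map (algebraMap E R) = 1 - c • (B * A) := by
    rw [← hV, hN, one_sub_smul_map_algebraMap]
  have hNB : N.map (algebraMap E R) * B = B * M.map (algebraMap E R) := by
    rw [hM', hN']
    simp [Matrix.sub_mul, Matrix.mul_sub, Matrix.mul_assoc]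
  have hadjM : M.map (algebraMap E R) * (adjugate M).map (algebraMap E R) = M.det • 1 := by
    rw [← Matrix.map_mul, mul_adjugate, smul_one_map_algebraMap]
  have hadjN : (adjugate N).map (algebraMap E R) * N.map (algebraMap E R) = N.det • 1 := by
    rw [← Matrix.map_mul, adjugate_mul, smul_one_map_algebraMap]
  have key : M.det • ((adjugate N).map (algebraMap E R) * B) =
      N.det • (B * (adjugate M).map (algebraMap E R)) := by
    calc _ = (adjugate N).map (algebraMap E R) * B *
          (M.map (algebraMap E R) * (adjugate M).map (algebraMap E R)) := by
          rw [hadjM]; simp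
      _ = (adjugate N).map (algebraMap E R) * N.map (algebraMap E R) * B *
          (adjugate M).map (algebraMap E R) := by
          rw [Matrix.mul_assoc _ _ B, hNB]; simp only [Matrix.mul_assoc]
      _ = _ := by rw [hadjN]; simp
  apply hinj
  rw [map_add, map_mul, map_mul, algebraMap_trace, algebraMap_trace,
    Matrix.map_mul, Matrix.map_mul, hU, hV, map_zero,
    ← Algebra.smul_def, ← Algebra.smul_def, ← trace_smul, ← Matrix.mul_assoc, ← Matrix.smul_mul, key,
    Matrix.smul_mul, trace_smul, ← smul_add, Matrix.mul_assoc, trace_mul_eq_neg_of_anticomm,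
    Matrix.mul_assoc, neg_add_cancel, smul_zero]
  intro k i
  rw [mul_apply, Finset.mul_sum, Finset.sum_mul, ← Finset.sum_neg_distrib]
  refine Finset.sum_congr rfl fun l _ => ?_
  rw [map_apply, ← Algebra.smul_def, smul_mul_assoc, mul_smul_comm, hAB, smul_neg, neg_neg]

theorem _root_.Polynomial.map_algebraMap_commute (p : Polynomial E) (q : Polynomial R) :
    p.map (algebraMap E R) * q = q * p.map (algebraMap E R) := by
  ext k
  rw [Polynomial.coeff_mul, Polynomial.coeff_mul, ← Finset.Nat.sum_antidiagonal_swap]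
  refine Finset.sum_congr rfl fun i _ => ?_
  simp [Algebra.commutes]

open Polynomial in
theorem derivative_det_one_sub_X_smul (Z : Matrix m m E) :
    derivative (1 - (X : E[X]) • Z.map C).det =
      -trace (adjugate (1 - (X : E[X]) • Z.map C) * Z.map C) := by
  have h : ∀ i j, derivative ((1 - (X : E[X]) • Z.map C) i j) = -C (Z i j) := by
    intro i j
    rw [sub_apply, smul_apply, map_apply, one_apply, smul_eq_mul, mul_comm]
    split_ifs <;> simp
  generalize 1 - (X : E[X]) • Z.map C = P at h ⊢
  have hd := Derivation.map_det (derivative' (R := E)) P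
  simp only [derivative'_apply] at hd
  rw [hd, Finset.sum_comm]
  simp only [h, trace, diag, mul_apply, ← Finset.sum_neg_distrib, map_apply, smul_eq_mul, mul_neg]

open Polynomial in
theorem eval_det_one_sub_X_smul (Z : Matrix m m E) (a : E) :
    eval a (1 - (X : E[X]) • Z.map C).det = (1 - a • Z).det := by
  rw [← coe_evalRingHom, RingHom.map_det]
  congr 1
  ext1 i j
  rw [RingHom.mapMatrix_apply, map_apply, sub_apply, smul_apply, map_apply, one_apply, sub_apply,
    smul_apply, one_apply, coe_evalRingHom, smul_eq_mul, eval_sub, eval_mul, eval_X, eval_C]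
  split_ifs <;> simp

open Polynomial in
/-- If `A` and `B` are odd, then `det (1 - A B) det (1 - B A) = 1`. -/
theorem det_one_sub_mul_det_one_sub_of_odd [IsAddTorsionFree E]
    (hinj : Function.Injective (algebraMap E R))
    (A : Matrix m n R) (B : Matrix n m R) (hAB : ∀ i j k l, A i j * B k l = -(B k l * A i j))
    (U : Matrix m m E) (V : Matrix n n E) (hU : U.map (algebraMap E R) = A * B)
    (hV : V.map (algebraMap E R) = B * A) : (1 - U).det * (1 - V).det = 1 := by
  -- A central parameter X deforms the identity: det(1 - XU) det(1 - XV) has derivative zero by the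
  -- trace relation with c = X.
  let ι : E[X] →+* R[X] := Polynomial.mapRingHom (algebraMap E R)
  let : Algebra E[X] R[X] := ι.toAlgebra' fun p q => p.map_algebraMap_commute q
  have hιinj : Function.Injective (algebraMap E[X] R[X]) := Polynomial.map_injective _ hinj
  have hU' : (U.map C).map (algebraMap E[X] R[X]) = A.map C * B.map C := by
    rw [← Matrix.map_mul, ← hU]
    ext1 i j
    simp
  have hV' : (V.map C).map (algebraMap E[X] R[X]) = B.map C * A.map C := by
    rw [← Matrix.map_mul, ← hV]
    ext1 i j
    simp
  have key := det_mul_trace_adjugate_add_of_odd hιinj (A.map C) (B.map C)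
    (fun i j k l => by simp only [map_apply]; rw [← C_mul, ← C_mul, ← C_neg, hAB]) _ _ hU' hV' X
  have hzero : derivative ((1 - (X : E[X]) • U.map C).det * (1 - (X : E[X]) • V.map C).det) = 0 := by
    rw [derivative_mul, derivative_det_one_sub_X_smul, derivative_det_one_sub_X_smul]
    linear_combination -key
  -- Torsion-freeness makes a polynomial with zero derivative constant. Its value at 0 is 1, its
  -- value at 1 the desired product.
  have hconst := eq_C_of_derivative_eq_zero hzero
  have h0 := congrArg (eval 0) hconst
  have h1 := congrArg (eval 1) hconst
  rw [eval_mul, eval_det_one_sub_X_smul, eval_det_one_sub_X_smul, eval_C] at h0 h1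
  rw [← h0] at h1
  simpa using h1

end Odd

end Matrix

/-! ### Even and odd parts, and odd derivations, axiomatically -/

/-- A ring `R` over a commutative ring `E` which plays the role of its even part, together with a
submodule of anticommuting odd elements. -/
structure SuperSplitting (E R : Type*) [CommRing E] [Ring R] [Algebra E R] where
  odd : Submodule E R
  evenPart : R →ₗ[E] E
  evenPart_one : evenPart 1 = 1
  anticomm : ∀ x ∈ odd, ∀ y ∈ odd, x * y = -(y * x)
  odd_mul_odd : ∀ x ∈ odd, ∀ y ∈ odd, x * y ∈ (algebraMap E R).range

/-- An odd derivation with respect to a super splitting. -/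
structure IsOddDerivation {E R : Type*} [CommRing E] [Ring R] [Algebra E R]
    (S : SuperSplitting E R) (D : R →+ R) : Prop where
  even_mul : ∀ (a : E) (x : R),
    D (algebraMap E R a * x) = D (algebraMap E R a) * x + algebraMap E R a * D x
  odd_mul : ∀ x ∈ S.odd, ∀ y, D (x * y) = D x * y - x * D y

theorem ringInverse_eq_of_mul_eq_one {R : Type*} [MonoidWithZero R] {a b : R} (hab : a * b = 1)
    (hba : b * a = 1) : Ring.inverse a = b :=
  Ring.inverse_unit ⟨a, b, hab, hba⟩

theorem ringInverse_algebraMap {E R : Type*} [CommRing E] [Ring R] [Algebra E R] {u : E}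
    (hu : IsUnit u) : Ring.inverse (algebraMap E R u) = algebraMap E R (Ring.inverse u) := by
  apply ringInverse_eq_of_mul_eq_one <;> rw [← map_mul]
  · rw [Ring.mul_inverse_cancel _ hu, map_one]
  · rw [Ring.inverse_mul_cancel _ hu, map_one]

namespace Matrix

variable {m k E R : Type*} [Fintype m] [CommRing E] [Ring R] [Algebra E R]

theorem map_algebraMap_mul_inv [DecidableEq m] {P : Matrix m m E} (hP : IsUnit P) :
    P.map (algebraMap E R) * P⁻¹.map (algebraMap E R) = 1 := by
  rw [← Matrix.map_mul, mul_nonsing_inv _ ((isUnit_iff_isUnit_det P).1 hP),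
    Matrix.map_one _ (map_zero _) (map_one _)]

theorem map_algebraMap_inv_mul [DecidableEq m] {P : Matrix m m E} (hP : IsUnit P) :
    P⁻¹.map (algebraMap E R) * P.map (algebraMap E R) = 1 := by
  rw [← Matrix.map_mul, nonsing_inv_mul _ ((isUnit_iff_isUnit_det P).1 hP),
    Matrix.map_one _ (map_zero _) (map_one _)]

theorem ringInverse_map_algebraMap [DecidableEq m] {P : Matrix m m E} (hP : IsUnit P) :
    Ring.inverse (P.map (algebraMap E R)) = P⁻¹.map (algebraMap E R) :=
  ringInverse_eq_of_mul_eq_one (map_algebraMap_mul_inv hP) (map_algebraMap_inv_mul hP)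

end Matrix

namespace SuperSplitting

open Matrix

variable {m k E R : Type*} [Fintype m] [CommRing E] [Ring R] [Algebra E R]


theorem evenPart_algebraMap (S : SuperSplitting E R) (a : E) : S.evenPart (algebraMap E R a) = a := by
  rw [Algebra.algebraMap_eq_smul_one, map_smul, S.evenPart_one, smul_eq_mul, mul_one]

theorem algebraMap_injective (S : SuperSplitting E R) : Function.Injective (algebraMap E R) :=
  Function.LeftInverse.injective S.evenPart_algebraMap

/-- An inverse over R need not visibly have even entries. The E-linear retraction `evenPart` turns a
right inverse over R into one over E, where one-sided inverses suffice. -/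
theorem isUnit_of_map (S : SuperSplitting E R) [DecidableEq m] {P : Matrix m m E}
    (hP : IsUnit (P.map (algebraMap E R))) : IsUnit P := by
  obtain ⟨V, hV⟩ := hP.exists_right_inv
  refine IsUnit.of_mul_eq_one (V.map S.evenPart) ?_
  have h := congrArg (fun M => M.map S.evenPart) hV
  rw [Matrix.map_one _ (map_zero _) S.evenPart_one] at h
  rw [← h]
  ext1 i j
  simp [mul_apply, ← Algebra.smul_def]

theorem exists_map_eq_mul (S : SuperSplitting E R) {A : Matrix k m R} {B : Matrix m k R}
    (hA : ∀ i j, A i j ∈ S.odd) (hB : ∀ i j, B i j ∈ S.odd) :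
    ∃ U : Matrix k k E, U.map (algebraMap E R) = A * B := by
  have : ∀ i j, ∃ u, algebraMap E R u = (A * B) i j := fun i j => by
    rw [mul_apply]
    exact Subring.sum_mem (algebraMap E R).range
      fun l _ => S.odd_mul_odd _ (hA i l) _ (hB l j)
  choose U hU using this
  exact ⟨of U, by ext1 i j; exact hU i j⟩

theorem map_mul_mem_odd (S : SuperSplitting E R) {l : Type*} (A : Matrix l m E) {B : Matrix m k R}
    (hB : ∀ i j, B i j ∈ S.odd) (i : l) (j : k) : (A.map (algebraMap E R) * B) i j ∈ S.odd := by
  rw [mul_apply]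
  refine Submodule.sum_mem _ fun n _ => ?_
  rw [map_apply, ← Algebra.smul_def]
  exact S.odd.smul_mem _ (hB n j)

/-- A product of two odd entries is even, so the Schur complement comes from a matrix over E and has
an ordinary determinant. -/
theorem exists_map_eq_schur (σ : SuperSplitting E R) (T : Matrix k k E)
    {Q : Matrix k m R} {Q' : Matrix m k R} (P : Matrix m m E)
    (hQ : ∀ i j, Q i j ∈ σ.odd) (hQ' : ∀ i j, Q' i j ∈ σ.odd) :
    ∃ S : Matrix k k E, S.map (algebraMap E R) =
      T.map (algebraMap E R) - Q * P.map (algebraMap E R) * Q' := by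
  obtain ⟨U, hU⟩ := σ.exists_map_eq_mul hQ (σ.map_mul_mem_odd P hQ')
  exact ⟨T - U, by rw [Matrix.map_sub _ (map_sub _), hU, Matrix.mul_assoc]⟩

end SuperSplitting

/-! ### Berezinians in block form, and Ber · Ber* = 1 -/

/-- The Berezinian in terms of the four blocks of a matrix. -/
noncomputable def berBlocks {m k R : Type*} [Ring R] [Fintype m] [LinearOrder m] [Fintype k]
    [LinearOrder k] (T : Matrix k k R) (Q : Matrix k m R) (Q' : Matrix m k R) (P : Matrix m m R) :
    R :=
  rowDet (T - Q * Ring.inverse P * Q') * Ring.inverse (rowDet P)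

section berBlocks

open Matrix

variable {m k E R : Type*} [Fintype m] [LinearOrder m] [Fintype k] [LinearOrder k]
  [CommRing E] [Ring R] [Algebra E R]

theorem berBlocks_eq_algebraMap {S : Matrix k k E} {P : Matrix m m E}
    (T : Matrix k k R) (Q : Matrix k m R) (Q' : Matrix m k R)
    (hP : IsUnit P) (hS : S.map (algebraMap E R) = T - Q * P⁻¹.map (algebraMap E R) * Q') :
    berBlocks T Q Q' (P.map (algebraMap E R)) = algebraMap E R (S.det * Ring.inverse P.det) := by
  rw [berBlocks, ringInverse_map_algebraMap hP, ← hS, rowDet_map_algebraMap, rowDet_map_algebraMap,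
    ringInverse_algebraMap ((isUnit_iff_isUnit_det P).1 hP), map_mul]

/-- The Berezinian and the inverse Berezinian are inverse to each other. -/
theorem berBlocks_mul_berBlocks_swap [IsAddTorsionFree E] (σ : SuperSplitting E R)
    {m' k' : Type*} [Fintype m'] [LinearOrder m'] [Fintype k'] [LinearOrder k']
    (e : k' ≃ m) (f : m' ≃ k) (T : Matrix k k E) {Q : Matrix k m R} {Q' : Matrix m k R}
    (P : Matrix m m E) (hT : IsUnit T) (hP : IsUnit P)
    (hQ : ∀ i j, Q i j ∈ σ.odd) (hQ' : ∀ i j, Q' i j ∈ σ.odd) :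
    ∃ w w' : E, w * w' = 1 ∧
      berBlocks (T.map (algebraMap E R)) Q Q' (P.map (algebraMap E R)) = algebraMap E R w ∧
      berBlocks ((P.map (algebraMap E R)).submatrix e e) (Q'.submatrix e f) (Q.submatrix f e)
        ((T.map (algebraMap E R)).submatrix f f) = algebraMap E R w' := by
  -- With U = T⁻¹Q P⁻¹Q' and V = P⁻¹Q' T⁻¹Q, the two Schur complements are T(1 - U) and P(1 - V).
  obtain ⟨U, hU⟩ := σ.exists_map_eq_mul (σ.map_mul_mem_odd T⁻¹ hQ) (σ.map_mul_mem_odd P⁻¹ hQ')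
  obtain ⟨V, hV⟩ := σ.exists_map_eq_mul (σ.map_mul_mem_odd P⁻¹ hQ') (σ.map_mul_mem_odd T⁻¹ hQ)
  have hdet := det_one_sub_mul_det_one_sub_of_odd σ.algebraMap_injective _ _
    (fun i j k l => σ.anticomm _ (σ.map_mul_mem_odd T⁻¹ hQ i j) _ (σ.map_mul_mem_odd P⁻¹ hQ' k l))
    U V hU hV
  have hTu := (isUnit_iff_isUnit_det T).1 hT
  have hPu := (isUnit_iff_isUnit_det P).1 hP
  refine ⟨(T * (1 - U)).det * Ring.inverse P.det,
    ((P * (1 - V)).submatrix e e).det * Ring.inverse (T.submatrix f f).det, ?_, ?_, ?_⟩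
  · rw [det_submatrix_equiv_self, det_submatrix_equiv_self, det_mul, det_mul]
    have h1 := Ring.mul_inverse_cancel _ hTu
    have h2 := Ring.mul_inverse_cancel _ hPu
    calc _ = (T.det * Ring.inverse T.det) * (P.det * Ring.inverse P.det) *
          ((1 - U).det * (1 - V).det) := by ring
      _ = 1 := by rw [h1, h2, hdet, one_mul, one_mul]
  · refine berBlocks_eq_algebraMap _ _ _ hP ?_
    rw [mul_sub, mul_one, Matrix.map_sub _ (map_sub _), Matrix.map_mul, hU]
    simp only [← Matrix.mul_assoc]
    rw [map_algebraMap_mul_inv hT, Matrix.one_mul]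
  · have hTf : IsUnit (T.submatrix f f) := by
      rwa [isUnit_iff_isUnit_det, det_submatrix_equiv_self]
    rw [submatrix_map (algebraMap E R) f f T]
    refine berBlocks_eq_algebraMap _ _ _ hTf ?_
    rw [← submatrix_map, inv_submatrix_equiv, ← submatrix_map, submatrix_mul_equiv,
      submatrix_mul_equiv]
    change _ = (P.map (algebraMap E R) - Q' * T⁻¹.map (algebraMap E R) * Q).submatrix e e
    congr 1
    rw [mul_sub, mul_one, Matrix.map_sub _ (map_sub _), Matrix.map_mul, hV]
    simp only [← Matrix.mul_assoc]
    rw [map_algebraMap_mul_inv hP, Matrix.one_mul]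

end berBlocks

/-! ### Odd derivation of a Berezinian in block form -/

section derivation

open Matrix

variable {m k E R : Type*} [CommRing E] [Ring R] [Algebra E R] {σ : SuperSplitting E R} {D : R →+ R}

/-- The restriction of an odd derivation to the even part. -/
def IsOddDerivation.onEven (hD : IsOddDerivation σ D) : Derivation ℤ E R :=
  Derivation.mk' (D.comp (algebraMap E R).toAddMonoidHom).toIntLinearMap fun a b => by
    change D (algebraMap E R (a * b)) = a • D (algebraMap E R b) + b • D (algebraMap E R a)
    rw [map_mul, hD.even_mul, Algebra.smul_def, Algebra.smul_def, Algebra.commutes b, add_comm]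

theorem IsOddDerivation.onEven_apply (hD : IsOddDerivation σ D) (a : E) :
    hD.onEven a = D (algebraMap E R a) := rfl

theorem IsOddDerivation.map_even_mul (hD : IsOddDerivation σ D) [Fintype m] {l : Type*}
    (P : Matrix l m E) (C : Matrix m k R) :
    (P.map (algebraMap E R) * C).map D =
      (P.map (algebraMap E R)).map D * C + P.map (algebraMap E R) * C.map D := by
  ext1 i j
  simp [mul_apply, hD.even_mul, Finset.sum_add_distrib]

theorem IsOddDerivation.map_odd_mul (hD : IsOddDerivation σ D) [Fintype m] {l : Type*}
    {Q : Matrix l m R} (hQ : ∀ i j, Q i j ∈ σ.odd) (C : Matrix m k R) :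
    (Q * C).map D = Q.map D * C - Q * C.map D := by
  ext1 i j
  simp [mul_apply, hD.odd_mul _ (hQ _ _), Finset.sum_sub_distrib]

variable [Fintype m] [Fintype k]

/-- Put C = P⁻¹Q'. Differentiating PC = Q' gives DC = P⁻¹JS without a formula for D(P⁻¹). In DT -
D(QC) the terms with K cancel, since PC = Q'; the sign rule for the odd Q makes Q·DC enter with a
plus. -/
theorem IsOddDerivation.map_schur [DecidableEq m] (hD : IsOddDerivation σ D) (T S : Matrix k k E)
    {Q : Matrix k m R} {Q' : Matrix m k R} {P : Matrix m m E} (hP : IsUnit P)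
    (hQ : ∀ i j, Q i j ∈ σ.odd)
    (hS : S.map (algebraMap E R) = T.map (algebraMap E R) - Q * P⁻¹.map (algebraMap E R) * Q')
    (J : Matrix m k E) (K : Matrix k m E) (q : Matrix k m R) (t : Matrix k k R)
    (hDP : (P.map (algebraMap E R)).map D = J.map (algebraMap E R) * Q)
    (hDQ' : Q'.map D = J.map (algebraMap E R) * T.map (algebraMap E R))
    (hDQ : Q.map D = K.map (algebraMap E R) * P.map (algebraMap E R) + q)
    (hDT : (T.map (algebraMap E R)).map D = K.map (algebraMap E R) * Q' + t) :
    (S.map (algebraMap E R)).map D = t - q * P⁻¹.map (algebraMap E R) * Q' +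
      Q * P⁻¹.map (algebraMap E R) * J.map (algebraMap E R) * S.map (algebraMap E R) := by
  set C := P⁻¹.map (algebraMap E R) * Q' with hC
  have hPC : P.map (algebraMap E R) * C = Q' := by
    rw [hC, ← Matrix.mul_assoc, map_algebraMap_mul_inv hP, Matrix.one_mul]
  rw [Matrix.mul_assoc _ _ Q', ← hC] at hS ⊢
  have hDC : C.map D =
      P⁻¹.map (algebraMap E R) * (J.map (algebraMap E R) * S.map (algebraMap E R)) := by
    have h := hD.map_even_mul P C
    rw [hPC, hDQ', hDP] at h
    rw [hS, Matrix.mul_sub, ← Matrix.mul_assoc (J.map _) Q C, h, add_sub_cancel_left,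
      ← Matrix.mul_assoc, map_algebraMap_inv_mul hP, Matrix.one_mul]
  have hmap : (S.map (algebraMap E R)).map D =
      (T.map (algebraMap E R)).map D - (Q * C).map D := by
    rw [hS]
    exact Matrix.map_sub _ (map_sub _) _ _
  rw [hmap, hD.map_odd_mul hQ, hDT, hDQ, hDC, Matrix.add_mul, Matrix.mul_assoc _ _ C, hPC]
  simp only [Matrix.mul_assoc]
  abel

variable [LinearOrder m] [LinearOrder k]

theorem IsOddDerivation.map_berBlocks (hD : IsOddDerivation σ D) (T : Matrix k k E)
    {Q : Matrix k m R} {Q' : Matrix m k R} {P : Matrix m m E} (hP : IsUnit P)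
    (hQ : ∀ i j, Q i j ∈ σ.odd) (hQ' : ∀ i j, Q' i j ∈ σ.odd)
    (J : Matrix m k E) (K : Matrix k m E) (l : k) (q : m → R) (t : k → R)
    (hDP : (P.map (algebraMap E R)).map D = J.map (algebraMap E R) * Q)
    (hDQ' : Q'.map D = J.map (algebraMap E R) * T.map (algebraMap E R))
    (hDQ : Q.map D = K.map (algebraMap E R) * P.map (algebraMap E R) + updateRow 0 l q)
    (hDT : (T.map (algebraMap E R)).map D = K.map (algebraMap E R) * Q' + updateRow 0 l t) :
    D (berBlocks (T.map (algebraMap E R)) Q Q' (P.map (algebraMap E R))) =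
      berBlocks ((T.map (algebraMap E R)).updateRow l t) (Q.updateRow l q) Q'
        (P.map (algebraMap E R)) := by
  obtain ⟨S, hS⟩ := σ.exists_map_eq_schur T P⁻¹ hQ hQ'
  have hDS := hD.map_schur T S hP hQ hS J K _ _ hDP hDQ' hDQ hDT
  have hu := (isUnit_iff_isUnit_det P).1 hP
  -- This is row l of the new Schur complement; its other rows are those of S, since only row l of T
  -- and Q changes.
  set r : k → R := t - q ᵥ* (P⁻¹.map (algebraMap E R) * Q') with hr
  have hδ : updateRow 0 l t - updateRow 0 l q * P⁻¹.map (algebraMap E R) * Q' =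
      updateRow 0 l r := by
    rw [Matrix.mul_assoc]
    ext1 i j
    by_cases h : i = l
    · subst h; simp [hr, mul_apply, vecMul, dotProduct]
    · simp [h, mul_apply, updateRow_ne]
  have hS' : (T.map (algebraMap E R)).updateRow l t -
      Q.updateRow l q * P⁻¹.map (algebraMap E R) * Q' =
      (S.map (algebraMap E R)).updateRow l r := by
    rw [hS, Matrix.mul_assoc, Matrix.mul_assoc]
    ext1 i j
    by_cases h : i = l
    · subst h; simp [hr, mul_apply, vecMul, dotProduct]
    · simp [h, mul_apply, updateRow_ne]
  rw [hδ] at hDS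
  set Z := Q * P⁻¹.map (algebraMap E R) * J.map (algebraMap E R) with hZ
  have hdetS : hD.onEven S.det = rowDet ((S.map (algebraMap E R)).updateRow l r) +
      S.det • trace Z := by
    have hentry : ∀ i j, hD.onEven (S i j) =
        (updateRow 0 l r + Z * S.map (algebraMap E R)) i j := fun i j => by
      rw [← hDS]; rfl
    rw [Derivation.map_det]
    simp_rw [hentry, Matrix.add_apply, smul_add, Finset.sum_add_distrib]
    congr 1
    · rw [rowDet_updateRow_map, Finset.sum_eq_single l]
      · simp
      · intro i _ h; simp [updateRow_ne h]
      · simp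
    · have : S.det • trace Z = trace (Z * S.map (algebraMap E R) *
          (adjugate S).map (algebraMap E R)) := by
        rw [Matrix.mul_assoc, ← Matrix.map_mul, mul_adjugate, smul_one_map_algebraMap,
          Matrix.mul_smul, Matrix.mul_one, trace_smul]
      rw [this]
      simp only [trace, diag]
      refine Finset.sum_congr rfl fun i _ => ?_
      rw [mul_apply]
      refine Finset.sum_congr rfl fun j _ => ?_
      rw [map_apply, Algebra.smul_def, Algebra.commutes]
  -- The trace is that of JQP⁻¹; J has central entries, so it may be moved cyclically without a
  -- sign, giving the same Z as for S.
  have hdetP : hD.onEven P.det = P.det • trace Z := by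
    have hentry : ∀ i j, hD.onEven (P i j) = (J.map (algebraMap E R) * Q) i j := fun i j => by
      rw [← hDP]; rfl
    have hadj : (adjugate P).map (algebraMap E R) = P.det • P⁻¹.map (algebraMap E R) := by
      have : adjugate P = P.det • P⁻¹ := by
        rw [inv_def, smul_smul, Ring.mul_inverse_cancel _ hu, one_smul]
      rw [this]
      ext1 i j
      rw [map_apply, Matrix.smul_apply, Matrix.smul_apply, map_apply, smul_eq_mul, map_mul, Algebra.smul_def]
    have h : P.det • trace Z = trace (J.map (algebraMap E R) * Q *
        (adjugate P).map (algebraMap E R)) := by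
      rw [Matrix.mul_assoc, trace_map_mul_comm, hadj, Matrix.mul_smul, Matrix.smul_mul, trace_smul]
    rw [Derivation.map_det, h]
    simp only [trace, diag]
    refine Finset.sum_congr rfl fun i _ => ?_
    rw [mul_apply]
    refine Finset.sum_congr rfl fun j _ => ?_
    rw [hentry, map_apply, Algebra.smul_def, Algebra.commutes]
  set w := S.det * Ring.inverse P.det with hw
  have hwP : P.det * w = S.det := by
    rw [hw, mul_left_comm, Ring.mul_inverse_cancel _ hu, mul_one]
  rw [berBlocks_eq_algebraMap _ _ _ hP hS, ← hw, ← hD.onEven_apply, berBlocks,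
    ringInverse_map_algebraMap hP, hS', rowDet_map_algebraMap, ringInverse_algebraMap hu]
  -- The quotient is differentiated through det P · w = det S; the terms det S · tr Z cancel on the
  -- two sides.
  have h := hD.onEven.leibniz P.det w
  rw [hwP, hdetS, hdetP, smul_smul, mul_comm w, hwP, add_left_inj] at h
  rw [h, ← Algebra.commutes, ← Algebra.smul_def, smul_smul, Ring.inverse_mul_cancel _ hu, one_smul]

end derivation

/-! ### From blocks back to matrices with a parity format -/

section superBlock

open Matrix

variable {ι E R : Type*} [CommRing E] [Ring R] [Algebra E R]

theorem exists_map_eq_superBlock (p : ι → ZMod 2) {A : Matrix ι ι R}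
    (hA : ∀ i j, p i = p j → A i j ∈ (algebraMap E R).range) (a : ZMod 2) :
    ∃ P : Matrix {i // p i = a} {i // p i = a} E, P.map (algebraMap E R) = superBlock p A a a := by
  have : ∀ i j : {i // p i = a}, ∃ u, algebraMap E R u = superBlock p A a a i j := fun i j =>
    hA i j (i.2.trans j.2.symm)
  choose P hP using this
  exact ⟨of P, by ext1 i j; exact hP i j⟩

/-- N vanishes between rows and columns of equal parity, so only the parity a' opposite to a
survives in the intermediate sum. -/
theorem superBlock_mul [Fintype ι] (p : ι → ZMod 2) {N : Matrix ι ι R} (A : Matrix ι ι R)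
    (hN : ∀ i j, p i = p j → N i j = 0) {a a' : ZMod 2} (ha : ∀ b, b ≠ a ↔ b = a') (b : ZMod 2) :
    superBlock p (N * A) a b = superBlock p N a a' * superBlock p A a' b := by
  ext1 i j
  simp only [superBlock, submatrix_apply, mul_apply]
  rw [← Finset.sum_subset (Finset.filter_subset (fun k => p k = a') Finset.univ)]
  · exact Finset.sum_subtype _ (by simp) _
  · intro k _ hk
    have hk' : p i = p k := by
      by_contra hne
      exact hk (by simpa using (ha _).1 fun h => hne (i.2.trans h.symm))
    rw [hN _ _ hk', zero_mul]

variable [Fintype ι] [LinearOrder ι] {σ : SuperSplitting E R}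

theorem exists_ber_eq_algebraMap_of_mul_eq_one [IsAddTorsionFree E] (σ : SuperSplitting E R)
    (p : ι → ZMod 2) {A : Matrix ι ι R}
    (hA : ∀ i j, p i = p j → A i j ∈ (algebraMap E R).range)
    (hA' : ∀ i j, p i ≠ p j → A i j ∈ σ.odd) (h : BerDefined p A) (h' : BerStarDefined p A) :
    ∃ w w' : E, w * w' = 1 ∧ ber p A = algebraMap E R w ∧ berStar p A = algebraMap E R w' := by
  obtain ⟨T, hT⟩ := exists_map_eq_superBlock p hA 0
  obtain ⟨P, hP⟩ := exists_map_eq_superBlock p hA 1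
  -- The blocks of the reversed format are indexed by different subtypes; e and f identify them with
  -- the blocks of p.
  let e : {i // reversedFormat p i = 0} ≃ {i // p i = 1} :=
    Equiv.subtypeEquivRight fun i => by
      simp only [reversedFormat]; generalize p i = x; revert x; decide
  let f : {i // reversedFormat p i = 1} ≃ {i // p i = 0} :=
    Equiv.subtypeEquivRight fun i => by
      simp only [reversedFormat]; generalize p i = x; revert x; decide
  have hPu : IsUnit P := σ.isUnit_of_map (by rw [hP]; exact h)
  have hTu : IsUnit T := by
    have h2 : IsUnit (T.submatrix f f) := by
      refine σ.isUnit_of_map ?_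
      rw [← submatrix_map, hT]
      exact h'
    rwa [isUnit_iff_isUnit_det, det_submatrix_equiv_self, ← isUnit_iff_isUnit_det] at h2
  obtain ⟨w, w', hw, h1, h2⟩ := berBlocks_mul_berBlocks_swap σ e f T (Q := superBlock p A 0 1)
    (Q' := superBlock p A 1 0) P hTu hPu
    (fun i j => hA' _ _ (by rw [i.2, j.2]; decide))
    (fun i j => hA' _ _ (by rw [i.2, j.2]; decide))
  rw [hT, hP] at h1 h2
  exact ⟨w, w', hw, h1, h2⟩

/-- Splitting DA = NA + (row l) by parity yields the block equations with J = N₁₀ and K = N₀₁. As l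
is even, P and Q' are not touched by the replacement, so definedness persists. -/
theorem IsOddDerivation.map_ber {D : R →+ R} (hD : IsOddDerivation σ D)
    (p : ι → ZMod 2) {A : Matrix ι ι R}
    (hA : ∀ i j, p i = p j → A i j ∈ (algebraMap E R).range)
    (hA' : ∀ i j, p i ≠ p j → A i j ∈ σ.odd) (N : Matrix ι ι E)
    (hN : ∀ i j, p i = p j → N i j = 0) (l : ι) (hl : p l = 0) (a : ι → R)
    (hDA : A.map D = N.map (algebraMap E R) * A + updateRow 0 l a) (h : BerDefined p A) :
    BerDefined p (A.updateRow l a) ∧ D (ber p A) = ber p (A.updateRow l a) := by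
  have hl1 : ∀ i : {i // p i = 1}, (i : ι) ≠ l := by
    rintro ⟨i, hi⟩ rfl
    rw [hl] at hi
    exact absurd hi (by decide)
  have hu1 : ∀ b, superBlock p (A.updateRow l a) 1 b = superBlock p A 1 b := fun b => by
    ext1 i j
    exact congrFun (updateRow_ne (hl1 i)) _
  have hu0 : ∀ b, superBlock p (A.updateRow l a) 0 b =
      (superBlock p A 0 b).updateRow ⟨l, hl⟩ fun j => a j := fun b => by
    ext1 i j
    by_cases hi : i = ⟨l, hl⟩
    · subst hi; simp [superBlock]
    · have : (i : ι) ≠ l := fun h => hi (Subtype.ext h)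
      simp [superBlock, updateRow_ne hi, updateRow_ne this]
  have hN' : ∀ i j, p i = p j → N.map (algebraMap E R) i j = 0 := fun i j hij => by
    rw [map_apply, hN i j hij, map_zero]
  have hD1 : ∀ b, (superBlock p A 1 b).map D =
      (superBlock p N 1 0).map (algebraMap E R) * superBlock p A 0 b := fun b => by
    have h1 := congrArg (fun M => superBlock p M 1 b) hDA
    have h2 := superBlock_mul p A hN' (a := 1) (a' := 0) (by decide) b
    ext1 i j
    have h3 := congrFun (congrFun h1 i) j
    have h4 : (updateRow 0 l a : Matrix ι ι R) i j = 0 := congrFun (updateRow_ne (hl1 i)) _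
    have h5 := congrFun (congrFun h2 i) j
    refine (h3.trans (?_ : _ = superBlock p (N.map (algebraMap E R) * A) 1 b i j)).trans h5
    simp only [superBlock, submatrix_apply, Matrix.add_apply, h4, add_zero]
  have hD0 : ∀ b, (superBlock p A 0 b).map D =
      (superBlock p N 0 1).map (algebraMap E R) * superBlock p A 1 b +
        updateRow 0 (⟨l, hl⟩ : {i // p i = 0}) (fun j : {j // p j = b} => a j) := fun b => by
    have h1 := congrArg (fun M => superBlock p M 0 b) hDA
    have h2 := superBlock_mul p A hN' (a := 0) (a' := 1) (by decide) b
    ext1 i j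
    have h3 := congrFun (congrFun h1 i) j
    have h5 := congrFun (congrFun h2 i) j
    refine h3.trans ?_
    refine congrArg₂ (· + ·) h5 ?_
    by_cases hi : i = ⟨l, hl⟩
    · subst hi; simp
    · have : (i : ι) ≠ l := fun h => hi (Subtype.ext h)
      simp [updateRow_ne hi, updateRow_ne this]
  refine ⟨by rw [BerDefined, hu1]; exact h, ?_⟩
  obtain ⟨T, hT⟩ := exists_map_eq_superBlock p hA 0
  obtain ⟨P, hP⟩ := exists_map_eq_superBlock p hA 1
  have hPu : IsUnit P := σ.isUnit_of_map (by rw [hP]; exact h)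
  have key := hD.map_berBlocks T (Q := superBlock p A 0 1) (Q' := superBlock p A 1 0) hPu
    (fun i j => hA' _ _ (by rw [i.2, j.2]; decide))
    (fun i j => hA' _ _ (by rw [i.2, j.2]; decide)) (superBlock p N 1 0) (superBlock p N 0 1)
    ⟨l, hl⟩ (fun j => a j) (fun j => a j) (by rw [hP]; exact hD1 1) (by rw [hT]; exact hD1 0)
    (by rw [hP]; exact hD0 1) (by rw [hT]; exact hD0 0)
  rw [hT, hP] at key
  change _ = berBlocks (superBlock p (A.updateRow l a) 0 0) (superBlock p (A.updateRow l a) 0 1)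
    (superBlock p (A.updateRow l a) 1 0) (superBlock p (A.updateRow l a) 1 1)
  rw [hu1, hu1, hu0, hu0]
  exact key

theorem IsOddDerivation.map_of_mul_eq_one {D : R →+ R} (hD : IsOddDerivation σ D) {w w' : E}
    (h : w * w' = 1) : D (algebraMap E R w) =
      -(algebraMap E R w ^ 2 * D (algebraMap E R w')) := by
  have := hD.onEven.leibniz_of_mul_eq_one h
  rwa [hD.onEven_apply, hD.onEven_apply, Algebra.smul_def, map_neg, map_pow, neg_mul] at this

end superBlock

/-! ### The superalgebra of functions on the superline -/

namespace SuperlineFunction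

universe v

variable {K : Type*} {B : Type v} [Field K] [Ring B] [Algebra K B] {𝓑 : ZMod 2 → Submodule K B}

theorem HasParity.add {f g : SuperlineFunction 𝓑} {q : ZMod 2} (hf : f.HasParity q)
    (hg : g.HasParity q) : (f + g).HasParity q :=
  ⟨add_mem hf.1 hg.1, add_mem hf.2 hg.2⟩

theorem HasParity.superD {dx : B →ₗ[K] B} (hdx : IsEvenDerivation 𝓑 dx) {f : SuperlineFunction 𝓑}
    {q : ZMod 2} (hf : f.HasParity q) : (superD dx f).HasParity (q + 1) := by
  refine ⟨hf.2, hdx.map_mem _ _ ?_⟩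
  rw [add_assoc, CharTwo.add_self_eq_zero, add_zero]
  exact hf.1

theorem HasParity.superD_iterate {dx : B →ₗ[K] B} (hdx : IsEvenDerivation 𝓑 dx)
    {f : SuperlineFunction 𝓑} {q : ZMod 2} (hf : f.HasParity q) (n : ℕ) :
    ((SuperlineFunction.superD dx)^[n] f).HasParity (q + n) := by
  induction n with
  | zero => simpa using hf
  | succ n ih =>
    rw [Function.iterate_succ_apply', Nat.cast_succ, ← add_assoc]
    exact ih.superD hdx

/-- The operator `D` as an additive map. -/
def superDHom (𝓑 : ZMod 2 → Submodule K B) [GradedAlgebra 𝓑] (dx : B →ₗ[K] B) :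
    SuperlineFunction 𝓑 →+ SuperlineFunction 𝓑 where
  toFun := superD dx
  map_zero' := by ext <;> simp [superD]
  map_add' f g := by ext <;> simp [superD]

variable [GradedAlgebra 𝓑]

theorem mul_comm_of_mem_zero (hB : IsSupercommutative 𝓑) {a : B} (ha : a ∈ 𝓑 0) (b : B) :
    a * b = b * a := by
  obtain ⟨u, hu, v, hv, rfl⟩ := exists_even_add_odd 𝓑 b
  rw [mul_add, add_mul, hB _ _ _ _ ha hu, hB _ _ _ _ ha hv]
  simp

theorem mul_of_mem_one (hB : IsSupercommutative 𝓑) {a : B} (ha : a ∈ 𝓑 1) (b : B) :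
    parityInvolution 𝓑 b * a = a * b := by
  obtain ⟨u, hu, v, hv, rfl⟩ := exists_even_add_odd 𝓑 b
  rw [parityInvolution_add, parityInvolution_of_even 𝓑 hu, parityInvolution_of_odd 𝓑 hv,
    add_mul, mul_add, hB _ _ _ _ ha hv, hB _ _ _ _ ha hu]
  simp [ZMod.val_one]

theorem mul_comm_of_hasParity_zero (hB : IsSupercommutative 𝓑) {f : SuperlineFunction 𝓑}
    (hf : f.HasParity 0) (g : SuperlineFunction 𝓑) : f * g = g * f := by
  ext
  · exact mul_comm_of_mem_zero hB hf.1 _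
  · have h1 : f.coeff1 ∈ 𝓑 1 := by simpa using hf.2
    rw [mul_coeff1, mul_coeff1, parityInvolution_of_even 𝓑 hf.1, mul_of_mem_one hB h1,
      mul_comm_of_mem_zero hB hf.1, add_comm]

theorem mul_eq_neg_of_hasParity_one (hB : IsSupercommutative 𝓑) {f g : SuperlineFunction 𝓑}
    (hf : f.HasParity 1) (hg : g.HasParity 1) : f * g = -(g * f) := by
  have hf1 : f.coeff1 ∈ 𝓑 0 := hf.2
  have hg1 : g.coeff1 ∈ 𝓑 0 := hg.2
  ext
  · rw [mul_coeff0, neg_coeff0, mul_coeff0, hB _ _ _ _ hf.1 hg.1]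
    simp [ZMod.val_one]
  · rw [mul_coeff1, neg_coeff1, mul_coeff1, parityInvolution_of_odd 𝓑 hf.1,
      parityInvolution_of_odd 𝓑 hg.1, mul_comm_of_mem_zero hB hf1, mul_comm_of_mem_zero hB hg1]
    noncomm_ring

theorem HasParity.mul {f g : SuperlineFunction 𝓑} {p q : ZMod 2} (hf : f.HasParity p)
    (hg : g.HasParity q) : (f * g).HasParity (p + q) := by
  have hinv : parityInvolution 𝓑 f.coeff0 ∈ 𝓑 p := by
    obtain rfl | rfl : p = 0 ∨ p = 1 := by clear hf; revert p; decide
    · rw [parityInvolution_of_even 𝓑 hf.1]; exact hf.1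
    · rw [parityInvolution_of_odd 𝓑 hf.1]; exact neg_mem hf.1
  refine ⟨SetLike.GradedMul.mul_mem hf.1 hg.1, add_mem ?_ ?_⟩
  · have := SetLike.GradedMul.mul_mem hf.2 hg.1
    rwa [add_right_comm] at this
  · have := SetLike.GradedMul.mul_mem hinv hg.2
    rwa [← add_assoc] at this

/-- The factor in front of Dg is the parity involution of f on the superline; its second coefficient
has a minus because ξ is odd. One formula thus covers both signs of the Leibniz rule. -/
theorem superD_mul {dx : B →ₗ[K] B} (hdx : IsEvenDerivation 𝓑 dx) (f g : SuperlineFunction 𝓑) :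
    superD dx (f * g) = superD dx f * g +
      ⟨parityInvolution 𝓑 f.coeff0, -parityInvolution 𝓑 f.coeff1⟩ * superD dx g := by
  have h2 : parityInvolution 𝓑 (parityInvolution 𝓑 f.coeff0) = f.coeff0 := by
    obtain ⟨u, hu, v, hv, h⟩ := exists_even_add_odd 𝓑 f.coeff0
    rw [h]
    simp only [parityInvolution_add, parityInvolution_of_even 𝓑 hu, parityInvolution_of_odd 𝓑 hv,
      parityInvolution_neg, neg_neg]
  ext
  · simp [superD]
  · simp only [superD, mul_coeff0, mul_coeff1, add_coeff1, h2, hdx.leibniz]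
    noncomm_ring

theorem superD_mul_of_hasParity_zero {dx : B →ₗ[K] B} (hdx : IsEvenDerivation 𝓑 dx)
    {f : SuperlineFunction 𝓑} (hf : f.HasParity 0) (g : SuperlineFunction 𝓑) :
    superD dx (f * g) = superD dx f * g + f * superD dx g := by
  have h1 : f.coeff1 ∈ 𝓑 1 := by simpa using hf.2
  rw [superD_mul hdx, parityInvolution_of_even 𝓑 hf.1, parityInvolution_of_odd 𝓑 h1, neg_neg]

theorem superD_mul_of_hasParity_one {dx : B →ₗ[K] B} (hdx : IsEvenDerivation 𝓑 dx)
    {f : SuperlineFunction 𝓑} (hf : f.HasParity 1) (g : SuperlineFunction 𝓑) :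
    superD dx (f * g) = superD dx f * g - f * superD dx g := by
  have h1 : f.coeff1 ∈ 𝓑 0 := hf.2
  rw [superD_mul hdx, parityInvolution_of_odd 𝓑 hf.1, parityInvolution_of_even 𝓑 h1, sub_eq_add_neg,
    ← neg_mul]
  rfl

variable (𝓑) in
/-- The even functions on the superline. -/
def evenSubring : Subring (SuperlineFunction 𝓑) where
  carrier := {f | f.HasParity 0}
  mul_mem' hf hg := by simpa using HasParity.mul hf hg
  one_mem' := ⟨SetLike.GradedOne.one_mem, zero_mem _⟩
  add_mem' hf hg := hf.add hg
  zero_mem' := ⟨zero_mem _, zero_mem _⟩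
  neg_mem' hf := ⟨neg_mem hf.1, neg_mem hf.2⟩

/-- The even part of a function on the superline. -/
def evenComponent (f : SuperlineFunction 𝓑) : SuperlineFunction 𝓑 :=
  ⟨DirectSum.decompose 𝓑 f.coeff0 0, DirectSum.decompose 𝓑 f.coeff1 1⟩

theorem evenComponent_hasParity (f : SuperlineFunction 𝓑) : (evenComponent f).HasParity 0 :=
  ⟨SetLike.coe_mem _, by simp [evenComponent]⟩

theorem evenComponent_add (f g : SuperlineFunction 𝓑) :
    evenComponent (f + g) = evenComponent f + evenComponent g := by
  ext <;> simp [evenComponent]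

theorem evenComponent_mul {f : SuperlineFunction 𝓑} (hf : f.HasParity 0)
    (g : SuperlineFunction 𝓑) : evenComponent (f * g) = f * evenComponent g := by
  have h1 : f.coeff1 ∈ 𝓑 1 := by simpa using hf.2
  have e0 : ∀ i b, (DirectSum.decompose 𝓑 (f.coeff0 * b) i : B) =
      f.coeff0 * DirectSum.decompose 𝓑 b i := fun i b => by
    have h := DirectSum.coe_decompose_mul_add_of_left_mem 𝓑 (j := i) (b := b) hf.1
    rwa [zero_add] at h
  have e1 : ∀ b, (DirectSum.decompose 𝓑 (f.coeff1 * b) 1 : B) =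
      f.coeff1 * DirectSum.decompose 𝓑 b 0 := fun b => by
    have h := DirectSum.coe_decompose_mul_add_of_left_mem 𝓑 (j := 0) (b := b) h1
    rwa [add_zero] at h
  ext
  · exact e0 0 _
  · simp only [evenComponent, mul_coeff1, parityInvolution_of_even 𝓑 hf.1,
      DirectSum.decompose_add, DirectSum.add_apply, Submodule.coe_add]
    rw [e0, e1]

/-- E is the ring of even functions, which the sign rule makes commutative and central.
Characteristic zero enters only here, as torsion-freeness of E. -/
theorem exists_superSplitting [CharZero K] (hB : IsSupercommutative 𝓑) {dx : B →ₗ[K] B}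
    (hdx : IsEvenDerivation 𝓑 dx) :
    ∃ (E : Type v) (_ : CommRing E) (_ : Algebra E (SuperlineFunction 𝓑)) (_ : IsAddTorsionFree E)
      (σ : SuperSplitting E (SuperlineFunction 𝓑)),
      (∀ f : SuperlineFunction 𝓑, f.HasParity 0 →
        f ∈ (algebraMap E (SuperlineFunction 𝓑)).range) ∧
      (∀ f : SuperlineFunction 𝓑, f.HasParity 1 → f ∈ σ.odd) ∧
      IsOddDerivation σ (superDHom 𝓑 dx) := by
  let instE : CommRing (evenSubring 𝓑) :=
    { (evenSubring 𝓑).toRing with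
      mul_comm := fun a b => Subtype.ext (mul_comm_of_hasParity_zero hB a.2 b) }
  let instA : Algebra (evenSubring 𝓑) (SuperlineFunction 𝓑) :=
    (evenSubring 𝓑).subtype.toAlgebra' fun a b => mul_comm_of_hasParity_zero hB a.2 b
  have htf : IsAddTorsionFree (evenSubring 𝓑) := by
    have hn : ∀ (n : ℕ) (f : SuperlineFunction 𝓑), (n • f).coeff0 = n • f.coeff0 ∧
        (n • f).coeff1 = n • f.coeff1 := fun n f => by
      induction n with
      | zero => simp
      | succ n ih => simp only [succ_nsmul, add_coeff0, add_coeff1, ih.1, ih.2, and_self]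
    have : IsAddTorsionFree B := ⟨fun n hn0 x y hxy => by
      have h : (n : K) • x = (n : K) • y := by simpa only [Nat.cast_smul_eq_nsmul] using hxy
      exact (smul_right_injective B (Nat.cast_ne_zero.2 hn0)) h⟩
    refine ⟨fun n hn0 f g hfg => Subtype.ext ?_⟩
    have h := congrArg Subtype.val hfg
    change n • f.1 = n • g.1 at h
    have h0 := congrArg coeff0 h
    have h1 := congrArg coeff1 h
    rw [(hn _ _).1, (hn _ _).1] at h0
    rw [(hn _ _).2, (hn _ _).2] at h1
    ext
    · exact nsmul_right_injective hn0 h0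
    · exact nsmul_right_injective hn0 h1
  let σ : SuperSplitting (evenSubring 𝓑) (SuperlineFunction 𝓑) :=
    { odd :=
        { carrier := {f | f.HasParity 1}
          add_mem' := fun hf hg => hf.add hg
          zero_mem' := ⟨zero_mem _, zero_mem _⟩
          smul_mem' := fun a f hf => by
            have := HasParity.mul a.2 hf
            rwa [zero_add] at this }
      evenPart :=
        { toFun := fun f => ⟨evenComponent f, evenComponent_hasParity f⟩
          map_add' := fun f g => Subtype.ext (evenComponent_add f g)
          map_smul' := fun a f => Subtype.ext (evenComponent_mul a.2 f) }
      evenPart_one := Subtype.ext <| by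
        ext
        · exact DirectSum.decompose_of_mem_same 𝓑 SetLike.GradedOne.one_mem
        · simp [evenComponent]
      anticomm := fun f hf g hg => mul_eq_neg_of_hasParity_one hB hf hg
      odd_mul_odd := fun f hf g hg => ⟨⟨f * g, HasParity.mul hf hg⟩, rfl⟩ }
  exact ⟨evenSubring 𝓑, instE, instA, htf, σ, fun f hf => ⟨⟨f, hf⟩, rfl⟩, fun f hf => hf,
    ⟨fun a f => superD_mul_of_hasParity_zero hdx a.2 f,
      fun f hf g => superD_mul_of_hasParity_one hdx hf g⟩⟩

end SuperlineFunction

/-! ### Application to Wroński matrices -/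

section wronskian

open Matrix SuperlineFunction

variable {K B : Type*} [Field K] [Ring B] [Algebra K B] {𝓑 : ZMod 2 → Submodule K B}

theorem wronskiMatrix_hasParity {dx : B →ₗ[K] B} (hdx : IsEvenDerivation 𝓑 dx) {N : ℕ}
    {φ : Fin N → SuperlineFunction 𝓑} (hφ : AlternatingParity φ) (i j : Fin N) :
    (wronskiMatrix dx φ i j).HasParity (altFormat N i + altFormat N j) := by
  have := (hφ j).superD_iterate hdx i
  rwa [add_comm] at this

theorem wronskiMatrix_hasParity_of_eq {dx : B →ₗ[K] B} (hdx : IsEvenDerivation 𝓑 dx) {N : ℕ}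
    {φ : Fin N → SuperlineFunction 𝓑} (hφ : AlternatingParity φ) {i j : Fin N}
    (h : altFormat N i = altFormat N j) : (wronskiMatrix dx φ i j).HasParity 0 := by
  have := wronskiMatrix_hasParity hdx hφ i j
  rwa [h, CharTwo.add_self_eq_zero] at this

theorem wronskiMatrix_hasParity_of_ne {dx : B →ₗ[K] B} (hdx : IsEvenDerivation 𝓑 dx) {N : ℕ}
    {φ : Fin N → SuperlineFunction 𝓑} (hφ : AlternatingParity φ) {i j : Fin N}
    (h : altFormat N i ≠ altFormat N j) : (wronskiMatrix dx φ i j).HasParity 1 := by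
  have := wronskiMatrix_hasParity hdx hφ i j
  have h1 : ∀ a b : ZMod 2, a ≠ b → a + b = 1 := by decide
  rwa [h1 _ _ h] at this

variable [CharZero K] [GradedAlgebra 𝓑]

/-- The shift c treats both Berezinians at once: c = 0 is the alternating format and c = 1 the
reversed one. The last row must be even for p. -/
theorem superD_ber_wronskiMatrix (hB : IsSupercommutative 𝓑) {dx : B →ₗ[K] B}
    (hdx : IsEvenDerivation 𝓑 dx) {n : ℕ} {φ : Fin (n + 1) → SuperlineFunction 𝓑}
    (hφ : AlternatingParity φ) (p : Fin (n + 1) → ZMod 2) (c : ZMod 2)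
    (hp : ∀ i, p i = altFormat _ i + c) (hn : p (Fin.last n) = 0)
    (h : BerDefined p (wronskiMatrix dx φ)) :
    BerDefined p (wronskiMatrixShifted dx φ) ∧
      superD dx (ber p (wronskiMatrix dx φ)) = ber p (wronskiMatrixShifted dx φ) := by
  obtain ⟨E, _, _, _, σ, heven, hodd, hD⟩ := exists_superSplitting hB hdx
  have hpi : ∀ i j, p i = p j ↔ altFormat _ i = altFormat _ j := fun i j => by
    rw [hp, hp, add_left_inj]
  refine hD.map_ber p (A := wronskiMatrix dx φ)
    (fun i j hij => heven _ (wronskiMatrix_hasParity_of_eq hdx hφ ((hpi i j).1 hij)))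
    (fun i j hij => hodd _ (wronskiMatrix_hasParity_of_ne hdx hφ fun e => hij ((hpi i j).2 e)))
    -- The superdiagonal shift: D of row i is row i + 1. The last row has no successor and supplies
    -- the correction.
    (of fun i j => if (j : ℕ) = i + 1 then 1 else 0) ?_ (Fin.last n) hn _ ?_ h
  · intro i j hij
    rw [hpi, altFormat, altFormat] at hij
    rw [of_apply, if_neg]
    intro hj
    rw [hj, Nat.cast_succ] at hij
    exact absurd (left_eq_add.1 hij) (by decide)
  · ext1 i j
    have hl : superD dx (wronskiMatrix dx φ i j) = (superD dx)^[i + 1] (φ j) :=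
      (Function.iterate_succ_apply' _ _ _).symm
    change superD dx (wronskiMatrix dx φ i j) = _
    rw [hl, Matrix.add_apply, mul_apply]
    simp only [map_apply, of_apply, apply_ite, map_one, map_zero, ite_mul, one_mul, zero_mul]
    induction i using Fin.lastCases with
    | last =>
      rw [Finset.sum_eq_zero, updateRow_self, zero_add, Fin.val_last]
      intro k _
      rw [if_neg]
      have := k.2
      rw [Fin.val_last]
      omega
    | cast i =>
      rw [Finset.sum_eq_single i.succ, if_pos (by simp), updateRow_ne (Fin.castSucc_lt_last i).ne]
      · exact (add_zero _).symm
      · intro k _ hk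
        rw [if_neg]
        intro h
        exact hk (Fin.ext (by simpa using h))
      · simp

theorem superD_eq_neg_of_ber_berStar (hB : IsSupercommutative 𝓑) {dx : B →ₗ[K] B}
    (hdx : IsEvenDerivation 𝓑 dx) {N : ℕ} {φ : Fin N → SuperlineFunction 𝓑}
    (hφ : AlternatingParity φ) (h : BerDefined (altFormat N) (wronskiMatrix dx φ))
    (h' : BerStarDefined (altFormat N) (wronskiMatrix dx φ)) :
    superD dx (superWronskian dx φ) =
        -(superWronskian dx φ ^ 2 * superD dx (superWronskianStar dx φ)) ∧
      superD dx (superWronskianStar dx φ) =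
        -(superWronskianStar dx φ ^ 2 * superD dx (superWronskian dx φ)) := by
  obtain ⟨E, _, _, _, σ, heven, hodd, hD⟩ := exists_superSplitting hB hdx
  obtain ⟨w, w', hw, h1, h2⟩ := exists_ber_eq_algebraMap_of_mul_eq_one σ (altFormat N)
    (fun i j hij => heven _ (wronskiMatrix_hasParity_of_eq hdx hφ hij))
    (fun i j hij => hodd _ (wronskiMatrix_hasParity_of_ne hdx hφ hij)) h h'
  rw [superWronskian, superWronskianStar, h1, h2]
  exact ⟨hD.map_of_mul_eq_one hw, hD.map_of_mul_eq_one ((mul_comm w' w).trans hw)⟩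

end wronskian

theorem mainTheorem8 {K B : Type*} [Field K] [CharZero K] [Ring B] [Algebra K B]
    (𝓑 : ZMod 2 → Submodule K B) [GradedAlgebra 𝓑] (hB : IsSupercommutative 𝓑)
    (dx : B →ₗ[K] B) (hdx : IsEvenDerivation 𝓑 dx) (s : ℕ) :
    (∀ φ : Fin (2 * s + 1) → SuperlineFunction 𝓑, AlternatingParity φ →
      BerDefined (altFormat _) (wronskiMatrix dx φ) →
        BerDefined (altFormat _) (wronskiMatrixShifted dx φ) ∧
        SuperlineFunction.superD dx (superWronskian dx φ) =
          ber (altFormat _) (wronskiMatrixShifted dx φ)) ∧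
    (∀ φ : Fin (2 * s + 1 + 1) → SuperlineFunction 𝓑, AlternatingParity φ →
      BerDefined (altFormat _) (wronskiMatrix dx φ) →
      BerStarDefined (altFormat _) (wronskiMatrix dx φ) →
        BerStarDefined (altFormat _) (wronskiMatrixShifted dx φ) ∧
        SuperlineFunction.superD dx (superWronskian dx φ) =
          -(superWronskian dx φ ^ 2 * berStar (altFormat _) (wronskiMatrixShifted dx φ))) ∧
    (∀ φ : Fin (2 * s + 1 + 1) → SuperlineFunction 𝓑, AlternatingParity φ →
      BerStarDefined (altFormat _) (wronskiMatrix dx φ) →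
        BerStarDefined (altFormat _) (wronskiMatrixShifted dx φ) ∧
        SuperlineFunction.superD dx (superWronskianStar dx φ) =
          berStar (altFormat _) (wronskiMatrixShifted dx φ)) ∧
    (∀ φ : Fin (2 * s + 1) → SuperlineFunction 𝓑, AlternatingParity φ →
      BerDefined (altFormat _) (wronskiMatrix dx φ) →
      BerStarDefined (altFormat _) (wronskiMatrix dx φ) →
        BerDefined (altFormat _) (wronskiMatrixShifted dx φ) ∧
        SuperlineFunction.superD dx (superWronskianStar dx φ) =
          -(superWronskianStar dx φ ^ 2 * ber (altFormat _) (wronskiMatrixShifted dx φ))) := by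
  have h1 : ∀ φ : Fin (2 * s + 1) → SuperlineFunction 𝓑, AlternatingParity φ →
      BerDefined (altFormat _) (wronskiMatrix dx φ) →
        BerDefined (altFormat _) (wronskiMatrixShifted dx φ) ∧
        SuperlineFunction.superD dx (superWronskian dx φ) =
          ber (altFormat _) (wronskiMatrixShifted dx φ) := fun φ hφ h => by
    refine superD_ber_wronskiMatrix hB hdx hφ _ 0 (fun i => (add_zero _).symm) ?_ h
    rw [altFormat, Fin.val_last, Nat.cast_mul]
    exact zero_mul _
  have h3 : ∀ φ : Fin (2 * s + 1 + 1) → SuperlineFunction 𝓑, AlternatingParity φ →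
      BerStarDefined (altFormat _) (wronskiMatrix dx φ) →
        BerStarDefined (altFormat _) (wronskiMatrixShifted dx φ) ∧
        SuperlineFunction.superD dx (superWronskianStar dx φ) =
          berStar (altFormat _) (wronskiMatrixShifted dx φ) := fun φ hφ h => by
    -- The last index 2s + 1 is odd, hence even in the reversed format.
    refine superD_ber_wronskiMatrix hB hdx hφ _ 1 (fun i => rfl) ?_ h
    rw [reversedFormat, altFormat, Fin.val_last, Nat.cast_succ, Nat.cast_mul, add_assoc,
      CharTwo.add_self_eq_zero, add_zero]
    exact zero_mul _
  refine ⟨h1, fun φ hφ h h' => ⟨(h3 φ hφ h').1, ?_⟩, h3, fun φ hφ h h' => ⟨(h1 φ hφ h).1, ?_⟩⟩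
  · rw [← (h3 φ hφ h').2]
    exact (superD_eq_neg_of_ber_berStar hB hdx hφ h h').1
  · rw [← (h1 φ hφ h).2]
    exact (superD_eq_neg_of_ber_berStar hB hdx hφ h h').2
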